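/- For a nonempty integer partition $\pi$, let $s(\pi)$ denote its smallest part, and for $l\ge 1$ let $\delta_l=(l-1,l-2,\dots,1)$ be the triangular (staircase) partition whose parts are $1,2,\dots,l-1$, each occurring exactly once (so $\delta_1$ is empty). Let $\mathrm{spt}(n)$ be Andrews' smallest-parts function, the total number of occurrences of the smallest part, summed over all partitions of $n$. Let $\mathrm{spt}_o^{+}(n)$ be the total number of occurrences of the smallest part $s(\pi)$ in $\pi$, summed over all partitions $\pi$ of $n$ that contain no odd part greater than $2s(\pi)$. Let $\mathrm{spt}_o^{-}(n)$ be the total number of occurrences of $s(\pi)$ in $\pi$, summed over all partition pairs $\sigma=(\pi,\delta_{s(\pi)})$ of $n$, i.e. such that the sum of the parts of $\pi$ plus the sum $\binom{s(\pi)}{2}$ of the parts of $\delta_{s(\pi)}$ equals $n$, in which $\pi$ contains no odd part greater than $2s(\pi)$. Put $\mathrm{spt}_o(n)=\mathrm{spt}_o^{+}(n)-\mathrm{spt}_o^{-}(n)$. Then, for every integer $n\ge 0$, $$\mathrm{spt}_o(2n)=\mathrm{spt}(n)$$ (for $n=0$ all the counts are $0$). -/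

import Mathlib

namespace SptO

/-- The smallest part `s(π)` of a partition `π` (with the convention `0` for the empty partition,
which has no parts and so contributes nothing to any of the counts below). -/
def smallestPart {n : ℕ} (π : n.Partition) : ℕ :=
  π.parts.toFinset.min.untopD 0

/-- The number of times that the smallest part of `π` occurs in `π`. -/
def smallestCount {n : ℕ} (π : n.Partition) : ℕ :=
  π.parts.count (smallestPart π)

/-- No odd part of `π` is greater than `2 s(π)`. -/
def NoLargeOdd {n : ℕ} (π : n.Partition) : Prop :=
  ∀ i ∈ π.parts, Odd i → i ≤ 2 * smallestPart π

instance {n : ℕ} : DecidablePred (NoLargeOdd (n := n)) :=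
  fun π => inferInstanceAs (Decidable (∀ i ∈ π.parts, Odd i → i ≤ 2 * smallestPart π))

/-- `δ` is the triangular partition `δ_l`, with parts `1, 2, …, l - 1`, each occurring once. -/
def IsTriangular {n : ℕ} (l : ℕ) (δ : n.Partition) : Prop :=
  δ.parts = (Finset.Ico 1 l).val

instance {n : ℕ} (l : ℕ) : DecidablePred (IsTriangular (n := n) l) :=
  fun δ => inferInstanceAs (Decidable (δ.parts = (Finset.Ico 1 l).val))

/-- Andrews' function: the total number of smallest parts in all partitions of `n`. -/
def spt (n : ℕ) : ℕ :=
  ∑ π : n.Partition, smallestCount π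

/-- The total number of smallest parts in the partitions `π` of `n` in which no odd part is
greater than `2 s(π)`. -/
def sptOPlus (n : ℕ) : ℕ :=
  ∑ π : n.Partition with NoLargeOdd π, smallestCount π

/-- The total number of smallest parts of `π` in the pairs `(π, δ)` of partitions, of total size
`n`, such that no odd part of `π` is greater than `2 s(π)` and `δ = δ_{s(π)}`. -/
def sptOMinus (n : ℕ) : ℕ :=
  ∑ ab ∈ Finset.HasAntidiagonal.antidiagonal n,
    ∑ σ : ab.1.Partition × ab.2.Partition with
      NoLargeOdd σ.1 ∧ IsTriangular (smallestPart σ.1) σ.2, smallestCount σ.1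

/-- `spt_o(n) = spt_o⁺(n) - spt_o⁻(n)`, an integer. -/
def sptO (n : ℕ) : ℤ :=
  (sptOPlus n : ℤ) - (sptOMinus n : ℤ)

end SptO

/-! Write (b)_s for (1 - b)⋯(1 - b^s). Sorting by the smallest part s, the series of `sptO` is the
sum over s of q^s (1 - q^(s(s-1)/2)) / ((1 - q^s)² ∏_{s<i≤2s} (1 - q^i) ∏_{j>s} (1 - q^(2j))).
Multiplied by ∏_j (1 - q^(2j)), its terms become q^s (q)_{s-1}² (1 - q^(s(s-1)/2)) β_s with β =
`slaterBeta q`. The same factor turns the series of `spt`, with q replaced by q², into a sum of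
q^(2s) (q²)_{s-1}² / (q²)_s.

Bailey's lemma (`two_mul_sum_eq_of_bailey`) evaluates both sums. Each uses the difference of two
Bailey pairs: in base q, supported on even indices 2r (`symmSum_pentCoeff`, `symmSum_triCoeff`), and
in base q², on indices r (`symmSum_pentCoeff_sq`, `symmSum_triCoeff_sq`). Both differences have the
coefficients `pairDiff q r`, and the weight b^k / (1 - b^k)² is q^(2r) / (1 - q^(2r))² for (b, k) =
(q, 2r) and for (b, k) = (q², r), so the two sums agree. Subtracting the second pair removes the
pole at r = 0; in base q this is the role of the triangular partitions.

Limits are avoided by bounding the parts in terms of L: the finite Bailey sums agree modulo q^(L+1)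
(`sum_slater_sub_sum_euler_mem`), and L = 2n suffices for the coefficient of q^(2n). -/

namespace SptO

open Finset

/-! ### Four finite Bailey pairs, by telescoping -/

section QSeries

variable {K : Type*} [Field K]

/-- The `q`-factorial `(b; b)_n = (1 - b)(1 - b²)⋯(1 - bⁿ)`. -/
def qFactorial {R : Type*} [CommRing R] (b : R) (n : ℕ) : R :=
  ∏ i ∈ range n, (1 - b ^ (i + 1))

/-- The reciprocal `1 / (b; b)_k` of the `q`-factorial, extended by zero to negative `k`. -/
noncomputable def qRecip (b : K) (k : ℤ) : K :=
  if k < 0 then 0 else (qFactorial b k.toNat)⁻¹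

theorem qFactorial_succ {R : Type*} [CommRing R] (b : R) (n : ℕ) :
    qFactorial b (n + 1) = qFactorial b n * (1 - b ^ (n + 1)) :=
  prod_range_succ _ _

theorem qFactorial_ne_zero {b : K} (hb : ∀ k : ℕ, 0 < k → b ^ k ≠ 1) (n : ℕ) :
    qFactorial b n ≠ 0 :=
  prod_ne_zero_iff.2 fun i _ => sub_ne_zero.2 (hb (i + 1) i.succ_pos).symm

theorem qRecip_of_neg (b : K) {k : ℤ} (hk : k < 0) : qRecip b k = 0 := if_pos hk

theorem qRecip_natCast (b : K) (n : ℕ) : qRecip b (n : ℤ) = (qFactorial b n)⁻¹ := by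
  simp [qRecip]

/-- Extension by zero keeps the recurrence valid at k = 0, where 1 - b^0 vanishes. The telescoping
identities can therefore be checked for every r without boundary cases. -/
theorem qRecip_sub_one {b : K} (hb : ∀ k : ℕ, 0 < k → b ^ k ≠ 1) (k : ℤ) :
    qRecip b (k - 1) = (1 - b ^ k) * qRecip b k := by
  rcases lt_trichotomy k 0 with hk | rfl | hk
  · rw [qRecip_of_neg b hk, qRecip_of_neg b (by omega), mul_zero]
  · simp [qRecip_of_neg]
  · obtain ⟨n, rfl⟩ : ∃ n : ℕ, k = n + 1 := ⟨(k - 1).toNat, by omega⟩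
    have h1 := sub_ne_zero.2 (hb (n + 1) n.succ_pos).symm
    have h2 := qFactorial_ne_zero hb n
    rw [add_sub_cancel_right, qRecip_natCast, ← Nat.cast_succ, qRecip_natCast,
      Nat.succ_eq_add_one, qFactorial_succ, zpow_natCast]
    field_simp

theorem qRecip_sub_two {b : K} (hb : ∀ k : ℕ, 0 < k → b ^ k ≠ 1) (k : ℤ) :
    qRecip b (k - 2) = (1 - b ^ (k - 1)) * ((1 - b ^ k) * qRecip b k) := by
  rw [← qRecip_sub_one hb, ← qRecip_sub_one hb]
  congr 1
  ring

/-- The sum of `f r` over the integers `-M ≤ r < M`. -/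
def symmSum (M : ℕ) (f : ℤ → K) : K :=
  ∑ i ∈ range (2 * M), f ((i : ℤ) - M)

theorem symmSum_telescope (M : ℕ) (g : ℤ → K) :
    symmSum M (fun r => g (r + 1) - g r) = g M - g (-M) := by
  have h := sum_range_sub (fun i : ℕ => g ((i : ℤ) - M)) (2 * M)
  simp only [Nat.cast_add, Nat.cast_one, Nat.cast_mul, Nat.cast_ofNat, Nat.cast_zero, zero_sub] at h
  rw [show (2 * M - M : ℤ) = M by ring] at h
  rw [← h, symmSum]
  refine sum_congr rfl fun i _ => ?_
  rw [sub_add_eq_add_sub]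

theorem symmSum_sub (M : ℕ) (f g : ℤ → K) :
    symmSum M (fun r => f r - g r) = symmSum M f - symmSum M g :=
  sum_sub_distrib _ _

theorem mul_symmSum (M : ℕ) (c : K) (f : ℤ → K) :
    c * symmSum M f = symmSum M (fun r => c * f r) :=
  mul_sum _ _ _

theorem symmSum_congr (M : ℕ) {f g : ℤ → K} (h : ∀ r, f r = g r) : symmSum M f = symmSum M g :=
  sum_congr rfl fun _ _ => h _

theorem symmSum_eq_single {M : ℕ} (hM : 0 < M) {f : ℤ → K} (hf : ∀ r, r ≠ 0 → f r = 0) :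
    symmSum M f = f 0 := by
  rw [symmSum, sum_eq_single M]
  · simp
  · intro i _ hi
    exact hf _ (by omega)
  · intro h
    exact absurd (mem_range.2 (by omega)) h

/-- The alternating coefficients `(-1)^r q^{r(3r-1)}`. -/
noncomputable def pentCoeff (q : K) (r : ℤ) : K := (-1) ^ r * q ^ (r * (3 * r - 1))

/-- The alternating coefficients `(-1)^r q^{r(r-1)}`. -/
noncomputable def triCoeff (q : K) (r : ℤ) : K := (-1) ^ r * q ^ (r * (r - 1))

theorem pentCoeff_succ {q : K} (hq : q ≠ 0) (r : ℤ) :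
    pentCoeff q (r + 1) = -(q ^ 2 * (q ^ r) ^ 6) * pentCoeff q r := by
  have : (r + 1) * (3 * (r + 1) - 1) = r * (3 * r - 1) + 6 * r + 2 := by ring
  rw [pentCoeff, pentCoeff, this, zpow_add₀ hq, zpow_add₀ hq, zpow_add₀ (by simp), mul_comm 6 r,
    zpow_mul q r 6, zpow_one, zpow_ofNat, zpow_ofNat]
  ring

theorem triCoeff_succ {q : K} (hq : q ≠ 0) (r : ℤ) :
    triCoeff q (r + 1) = -(q ^ r) ^ 2 * triCoeff q r := by
  have : (r + 1) * ((r + 1) - 1) = r * (r - 1) + r * 2 := by ring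
  rw [triCoeff, triCoeff, this, zpow_add₀ hq, zpow_add₀ (by simp), zpow_mul q r 2, zpow_one,
    zpow_ofNat]
  ring

variable {q : K}

theorem sq_pow_ne_one (hq1 : ∀ k : ℕ, 0 < k → q ^ k ≠ 1) (k : ℕ) (hk : 0 < k) :
    (q ^ 2) ^ k ≠ 1 := by
  rw [← pow_mul]
  exact hq1 _ (by omega)

/-- The sequence `1 / ((q; q)_n (q; q²)_n)`. -/
noncomputable def slaterBeta (q : K) (n : ℕ) : K :=
  qFactorial (q ^ 2) n / (qFactorial q n * qFactorial q (2 * n))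

theorem slaterBeta_succ (hq1 : ∀ k : ℕ, 0 < k → q ^ k ≠ 1) (n : ℕ) :
    (1 - q ^ (n + 1)) * (1 - q ^ (2 * n + 1)) * slaterBeta q (n + 1) = slaterBeta q n := by
  have h1 := sub_ne_zero.2 (hq1 (n + 1) (by omega)).symm
  have h2 := sub_ne_zero.2 (hq1 (2 * n + 1) (by omega)).symm
  have h3 := sub_ne_zero.2 (hq1 (2 * n + 1 + 1) (by omega)).symm
  have h4 := qFactorial_ne_zero hq1 n
  have h5 := qFactorial_ne_zero hq1 (2 * n)
  rw [slaterBeta, slaterBeta, show 2 * (n + 1) = 2 * n + 1 + 1 by ring]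
  simp only [qFactorial_succ]
  rw [← pow_mul, show 2 * (n + 1) = 2 * n + 1 + 1 by ring]
  field_simp

/-- Creative telescoping: the certificate `G` reduces a recurrence in n for a sum over r to a
rational identity for each r. -/
theorem mul_symmSum_eq_of_telescope {M : ℕ} {a b : K} {f g G : ℤ → K}
    (h : ∀ r, a * f r - b * g r = G (r + 1) - G r) (h1 : G M = 0) (h2 : G (-M) = 0) :
    a * symmSum M f = b * symmSum M g := by
  have key := symmSum_telescope M G
  rw [← symmSum_congr M h, symmSum_sub, ← mul_symmSum, ← mul_symmSum, h1, h2, sub_zero] at key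
  exact sub_eq_zero.1 key

theorem symmSum_qRecip_zero {M : ℕ} (hM : 0 < M) (b : K) (c : ℤ → K) {d : ℤ} (hd : 0 < d) :
    symmSum M (fun r => c r * (qRecip b ((0 : ℕ) - d * r) * qRecip b ((0 : ℕ) + d * r))) = c 0 := by
  rw [symmSum_eq_single hM]
  · simp [qRecip, qFactorial]
  · intro r hr
    rcases lt_or_gt_of_ne hr with hr | hr
    · rw [qRecip_of_neg b (k := (0 : ℕ) + d * r) (by simpa using mul_neg_of_pos_of_neg hd hr)]
      ring
    · rw [qRecip_of_neg b (k := (0 : ℕ) - d * r) (by simpa using mul_pos hd hr)]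
      ring

theorem sq_zpow (q : K) (r : ℤ) : (q ^ 2) ^ r = (q ^ r) ^ 2 := by
  rw [← zpow_natCast, ← zpow_mul, ← zpow_natCast, ← zpow_mul, mul_comm]

theorem zpow_two_mul (q : K) (r : ℤ) : q ^ (2 * r) = (q ^ r) ^ 2 := by
  rw [zpow_mul, zpow_ofNat, sq_zpow]

/-- The factor 1 + q^(2r) makes the coefficients even in r. Summing over both signs of r thus
doubles the usual one-sided Bailey sum, which accounts for the 2. -/
theorem symmSum_pentCoeff_sq (hq : q ≠ 0) (hq1 : ∀ k : ℕ, 0 < k → q ^ k ≠ 1) {n M : ℕ}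
    (h : n < M) :
    symmSum M (fun r => pentCoeff q r * (1 + q ^ (2 * r)) *
      (qRecip (q ^ 2) (n - r) * qRecip (q ^ 2) (n + r))) = 2 / qFactorial (q ^ 2) n := by
  have hp1 := sq_pow_ne_one hq1
  have hp : q ^ 2 ≠ 0 := pow_ne_zero 2 hq
  induction n with
  | zero =>
    have := symmSum_qRecip_zero h (q ^ 2) (fun r => pentCoeff q r * (1 + q ^ (2 * r))) one_pos
    simp only [one_mul] at this
    rw [this]
    simp [pentCoeff, qFactorial]
    norm_num
  | succ n ih =>
    have hn := sub_ne_zero.2 (hp1 (n + 1) (by omega)).symm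
    rw [qFactorial_succ, ← div_div, eq_div_iff hn, ← ih (by omega), mul_comm, ← one_mul (symmSum M
      fun r => _ * (qRecip (q ^ 2) (n - r) * _))]
    -- Only the second factor of the certificate is shifted by -1, so `G r` and `G (r + 1)` are both
    -- elementary multiples of the summand at n + 1, and that summand cancels.
    refine mul_symmSum_eq_of_telescope (G := fun r : ℤ => -(q ^ 2) ^ (n + 1) * q ^ (-(2 * r)) *
      pentCoeff q r * (qRecip (q ^ 2) ((n + 1 : ℕ) - r) * qRecip (q ^ 2) ((n + 1 : ℕ) + r - 1)))
      (fun r => ?_) ?_ ?_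
    · have hx : q ^ r ≠ 0 := zpow_ne_zero r hq
      rw [show (n - r : ℤ) = (n + 1 : ℕ) - r - 1 by push_cast; ring,
        show (n + r : ℤ) = (n + 1 : ℕ) + r - 1 by push_cast; ring,
        show (((n + 1 : ℕ) : ℤ) - (r + 1)) = (n + 1 : ℕ) - r - 1 by ring,
        show (((n + 1 : ℕ) : ℤ) + (r + 1) - 1) = (n + 1 : ℕ) + r by ring,
        qRecip_sub_one hp1, qRecip_sub_one hp1, pentCoeff_succ hq, zpow_sub₀ hp, zpow_add₀ hp,
        zpow_neg, zpow_neg, zpow_two_mul, zpow_two_mul, zpow_add₀ hq, sq_zpow q r, zpow_natCast,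
        zpow_one]
      field_simp
      ring
    · rw [qRecip_of_neg _ (show (((n + 1 : ℕ) : ℤ) - M) < 0 by omega)]
      ring
    · rw [qRecip_of_neg _ (show (((n + 1 : ℕ) : ℤ) + -M - 1) < 0 by omega)]
      ring

theorem symmSum_triCoeff_sq (hq : q ≠ 0) (hq1 : ∀ k : ℕ, 0 < k → q ^ k ≠ 1) {n M : ℕ}
    (hn : 0 < n) (h : n < M) :
    symmSum M (fun r => triCoeff q r * (1 + q ^ (2 * r)) *
      (qRecip (q ^ 2) (n - r) * qRecip (q ^ 2) (n + r))) = 0 := by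
  have hp1 := sq_pow_ne_one hq1
  have hp : q ^ 2 ≠ 0 := pow_ne_zero 2 hq
  have hn := sub_ne_zero.2 (hp1 n hn).symm
  refine (mul_eq_zero.1 ?_).resolve_left hn
  rw [← zero_mul (symmSum M fun _ => 0)]
  refine mul_symmSum_eq_of_telescope (G := fun r : ℤ =>
      -triCoeff q r * (qRecip (q ^ 2) (n - r) * qRecip (q ^ 2) (n + r - 1)))
      (fun r => ?_) ?_ ?_
  · rw [show (n - (r + 1) : ℤ) = n - r - 1 by ring, show (n + (r + 1) - 1 : ℤ) = n + r by ring,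
      qRecip_sub_one hp1, qRecip_sub_one hp1, triCoeff_succ hq, zpow_sub₀ hp, zpow_add₀ hp,
      zpow_two_mul, sq_zpow q r, zpow_natCast]
    have hx : q ^ r ≠ 0 := zpow_ne_zero r hq
    field_simp
    ring
  · rw [qRecip_of_neg _ (show (n - M : ℤ) < 0 by omega)]
    ring
  · rw [qRecip_of_neg _ (show (n + -M - 1 : ℤ) < 0 by omega)]
    ring

theorem symmSum_pentCoeff (hq : q ≠ 0) (hq1 : ∀ k : ℕ, 0 < k → q ^ k ≠ 1) {n M : ℕ}
    (h : n < M) :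
    symmSum M (fun r => pentCoeff q r * (1 + q ^ (2 * r)) *
      (qRecip q (n - 2 * r) * qRecip q (n + 2 * r))) = 2 * slaterBeta q n := by
  induction n with
  | zero =>
    rw [symmSum_qRecip_zero h q (fun r => pentCoeff q r * (1 + q ^ (2 * r))) two_pos]
    simp [pentCoeff, slaterBeta, qFactorial]
    norm_num
  | succ n ih =>
    have h1 := sub_ne_zero.2 (hq1 (n + 1) (by omega)).symm
    have h2 := sub_ne_zero.2 (hq1 (2 * n + 1) (by omega)).symm
    refine mul_left_cancel₀ (mul_ne_zero h1 h2) ?_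
    rw [mul_left_comm _ 2, slaterBeta_succ hq1, ← ih (by omega), ← one_mul (symmSum M
      fun r => _ * (qRecip q (n - 2 * r) * _))]
    -- The index is now 2r, so a step in r moves it by two; hence the shift by -2.
    refine mul_symmSum_eq_of_telescope (G := fun r : ℤ => -q ^ (n + 1) * q ^ (-(2 * r)) *
      pentCoeff q r * (qRecip q ((n + 1 : ℕ) - 2 * r) * qRecip q ((n + 1 : ℕ) + 2 * r - 2)))
      (fun r => ?_) ?_ ?_
    · have hx : q ^ r ≠ 0 := zpow_ne_zero r hq
      rw [show (n - 2 * r : ℤ) = (n + 1 : ℕ) - 2 * r - 1 by push_cast; ring,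
        show (n + 2 * r : ℤ) = (n + 1 : ℕ) + 2 * r - 1 by push_cast; ring,
        show (((n + 1 : ℕ) : ℤ) - 2 * (r + 1)) = (n + 1 : ℕ) - 2 * r - 2 by ring,
        show (((n + 1 : ℕ) : ℤ) + 2 * (r + 1) - 2) = (n + 1 : ℕ) + 2 * r by ring,
        qRecip_sub_two hq1, qRecip_sub_two hq1, qRecip_sub_one hq1, qRecip_sub_one hq1,
        pentCoeff_succ hq, zpow_sub_one₀ hq, zpow_sub_one₀ hq, zpow_sub₀ hq, zpow_add₀ hq,
        zpow_neg, zpow_neg, zpow_two_mul, zpow_two_mul, zpow_add₀ hq, zpow_natCast, zpow_one]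
      field_simp
      ring
    · rw [qRecip_of_neg _ (show (((n + 1 : ℕ) : ℤ) - 2 * M) < 0 by omega)]
      ring
    · rw [qRecip_of_neg _ (show (((n + 1 : ℕ) : ℤ) + 2 * -M - 2) < 0 by omega)]
      ring

theorem symmSum_triCoeff (hq : q ≠ 0) (hq1 : ∀ k : ℕ, 0 < k → q ^ k ≠ 1) {n M : ℕ}
    (h : n < M) :
    symmSum M (fun r => triCoeff q r * (1 + q ^ (2 * r)) *
      (qRecip q (n - 2 * r) * qRecip q (n + 2 * r))) = 2 * (q ^ n.choose 2 * slaterBeta q n) := by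
  induction n with
  | zero =>
    rw [symmSum_qRecip_zero h q (fun r => triCoeff q r * (1 + q ^ (2 * r))) two_pos]
    simp [triCoeff, slaterBeta, qFactorial]
    norm_num
  | succ n ih =>
    have h1 := sub_ne_zero.2 (hq1 (n + 1) (by omega)).symm
    have h2 := sub_ne_zero.2 (hq1 (2 * n + 1) (by omega)).symm
    refine mul_left_cancel₀ (mul_ne_zero h1 h2) ?_
    have h3 : (1 - q ^ (n + 1)) * (1 - q ^ (2 * n + 1)) *
        (2 * (q ^ (n + 1).choose 2 * slaterBeta q (n + 1))) =
        q ^ n * (2 * (q ^ n.choose 2 * slaterBeta q n)) := by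
      rw [← slaterBeta_succ hq1 n, Nat.choose_succ_succ' n 1, Nat.choose_one_right, pow_add]
      ring
    rw [h3, ← ih (by omega)]
    refine mul_symmSum_eq_of_telescope (G := fun r : ℤ => -
      triCoeff q r * (qRecip q ((n + 1 : ℕ) - 2 * r) * qRecip q ((n + 1 : ℕ) + 2 * r - 2)))
      (fun r => ?_) ?_ ?_
    · have hx : q ^ r ≠ 0 := zpow_ne_zero r hq
      rw [show (n - 2 * r : ℤ) = (n + 1 : ℕ) - 2 * r - 1 by push_cast; ring,
        show (n + 2 * r : ℤ) = (n + 1 : ℕ) + 2 * r - 1 by push_cast; ring,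
        show (((n + 1 : ℕ) : ℤ) - 2 * (r + 1)) = (n + 1 : ℕ) - 2 * r - 2 by ring,
        show (((n + 1 : ℕ) : ℤ) + 2 * (r + 1) - 2) = (n + 1 : ℕ) + 2 * r by ring,
        qRecip_sub_two hq1, qRecip_sub_two hq1, qRecip_sub_one hq1, qRecip_sub_one hq1,
        triCoeff_succ hq, zpow_sub_one₀ hq, zpow_sub_one₀ hq, zpow_sub₀ hq, zpow_add₀ hq,
        zpow_two_mul, zpow_natCast]
      field_simp
      ring
    · rw [qRecip_of_neg _ (show (((n + 1 : ℕ) : ℤ) - 2 * M) < 0 by omega)]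
      ring
    · rw [qRecip_of_neg _ (show (((n + 1 : ℕ) : ℤ) + 2 * -M - 2) < 0 by omega)]
      ring

/-- The sum telescopes in N because (1 - b^m)² - (1 - b^(m-r))(1 - b^(m+r)) = b^(m-r) (1 - b^r)². -/
theorem sum_qFactorial_sq_mul_qRecip {b : K} (hb : b ≠ 0) (hb1 : ∀ k : ℕ, 0 < k → b ^ k ≠ 1)
    {r : ℤ} (hr : r ≠ 0) (N : ℕ) :
    ∑ n ∈ range N, b ^ (n + 1) * qFactorial b n ^ 2 *
      (qRecip b ((n + 1 : ℕ) - r) * qRecip b ((n + 1 : ℕ) + r)) =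
    b ^ r / (1 - b ^ r) ^ 2 * (qFactorial b N ^ 2 * (qRecip b (N - r) * qRecip b (N + r))) := by
  have hr1 : 1 - b ^ r ≠ 0 := by
    rw [sub_ne_zero]
    rcases Int.eq_nat_or_neg r with ⟨k, rfl | rfl⟩
    · rw [zpow_natCast]
      exact (hb1 k (by omega)).symm
    · rw [zpow_neg, zpow_natCast, ne_comm, ne_eq, inv_eq_one]
      exact hb1 k (by omega)
  induction N with
  | zero =>
    rcases lt_or_gt_of_ne hr with hr | hr
    · rw [qRecip_of_neg b (k := (0 : ℕ) + r) (by simpa using hr)]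
      simp
    · rw [qRecip_of_neg b (k := (0 : ℕ) - r) (by simpa using hr)]
      simp
  | succ N ih =>
    have hx : b ^ r ≠ 0 := zpow_ne_zero r hb
    rw [sum_range_succ, ih, show (N - r : ℤ) = (N + 1 : ℕ) - r - 1 by push_cast; ring,
      show (N + r : ℤ) = (N + 1 : ℕ) + r - 1 by push_cast; ring, qRecip_sub_one hb1,
      qRecip_sub_one hb1, qFactorial_succ, zpow_sub₀ hb, zpow_add₀ hb, zpow_natCast]
    field_simp
    ring

end QSeries

/-! ### Bailey's lemma and the comparison of the two sums modulo q^(N+1) -/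

section Congruence

variable {K : Type*} [Field K] {q : K} {O : Subring K}

/-- The difference of the coefficients of the two Bailey pairs, with their symmetric factors. -/
noncomputable def pairDiff (q : K) (r : ℤ) : K :=
  (pentCoeff q r - triCoeff q r) * (1 + q ^ (2 * r))

theorem pairDiff_zero (q : K) : pairDiff q 0 = 0 := by
  simp [pairDiff, pentCoeff, triCoeff]

/-- A finite form of Bailey's lemma with both parameters specialised to 1: insert the pair and
interchange the sums. The assumption `D 0 = 0` discards r = 0, where the weight has a pole. -/
theorem two_mul_sum_eq_of_bailey {b : K} (hb : b ≠ 0) (hb1 : ∀ k : ℕ, 0 < k → b ^ k ≠ 1)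
    {M N : ℕ} {d : ℤ} (hd : 0 < d) {D : ℤ → K} (hD : D 0 = 0) {β : ℕ → K}
    (hβ : ∀ n, n < N → symmSum M (fun r => D r *
      (qRecip b ((n + 1 : ℕ) - d * r) * qRecip b ((n + 1 : ℕ) + d * r))) = 2 * β (n + 1)) :
    2 * ∑ n ∈ range N, b ^ (n + 1) * qFactorial b n ^ 2 * β (n + 1) =
      symmSum M (fun r => D r * (b ^ (d * r) / (1 - b ^ (d * r)) ^ 2 *
        (qFactorial b N ^ 2 * (qRecip b (N - d * r) * qRecip b (N + d * r))))) := by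
  have h1 : ∀ r : ℤ, D r * (b ^ (d * r) / (1 - b ^ (d * r)) ^ 2 *
        (qFactorial b N ^ 2 * (qRecip b (N - d * r) * qRecip b (N + d * r)))) =
      ∑ n ∈ range N, b ^ (n + 1) * qFactorial b n ^ 2 *
        (D r * (qRecip b ((n + 1 : ℕ) - d * r) * qRecip b ((n + 1 : ℕ) + d * r))) := by
    intro r
    rcases eq_or_ne r 0 with rfl | hr
    · simp [hD]
    · rw [← sum_qFactorial_sq_mul_qRecip hb hb1 (mul_ne_zero hd.ne' hr), mul_sum]
      exact sum_congr rfl fun n _ => by ring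
  rw [symmSum_congr M h1, symmSum, sum_comm, mul_sum]
  refine sum_congr rfl fun n hn => ?_
  rw [mul_left_comm, ← hβ n (mem_range.1 hn), symmSum, mul_sum]

theorem qFactorial_mem {b : K} (hb : b ∈ O) (n : ℕ) : qFactorial b n ∈ O :=
  prod_mem fun _ _ => sub_mem (one_mem O) (pow_mem hb _)

theorem qFactorial_inv_mem {b : K} (hb : ∀ k : ℕ, 0 < k → (1 - b ^ k)⁻¹ ∈ O) (n : ℕ) :
    (qFactorial b n)⁻¹ ∈ O := by
  rw [qFactorial, ← prod_inv_distrib]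
  exact prod_mem fun i _ => hb (i + 1) i.succ_pos

/-- The ratio of `q`-factorials `(b; b)_{m + j} / (b; b)_m` is `1` modulo `b ^ (m + 1)`. -/
theorem qFactorial_add_sub_mem {b : K} (hb : b ∈ O) (m j : ℕ) :
    ∃ c ∈ O, qFactorial b (m + j) = qFactorial b m * (1 + b ^ (m + 1) * c) := by
  induction j with
  | zero => exact ⟨0, zero_mem O, by simp⟩
  | succ j ih =>
    obtain ⟨c, hc, h⟩ := ih
    refine ⟨c - b ^ j * (1 + b ^ (m + 1) * c), sub_mem hc (mul_mem (pow_mem hb _)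
      (add_mem (one_mem O) (mul_mem (pow_mem hb _) hc))), ?_⟩
    rw [← add_assoc, qFactorial_succ, h]
    ring

/-- The ratio `(b; b)_{m + j}² / ((b; b)_m (b; b)_{m + 2j})` is `1` modulo `b ^ (m + 1)`. -/
theorem qFactorial_ratio_sub_one_mem {b : K} (hb : b ∈ O) (hb1 : ∀ k : ℕ, 0 < k → b ^ k ≠ 1)
    (hbO : ∀ k : ℕ, 0 < k → (1 - b ^ k)⁻¹ ∈ O) (m j : ℕ) :
    ∃ c ∈ O, qFactorial b (m + j) ^ 2 * ((qFactorial b m)⁻¹ * (qFactorial b (m + 2 * j))⁻¹) =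
      1 + b ^ (m + 1) * c := by
  obtain ⟨c, hc, h⟩ := qFactorial_add_sub_mem (O := O) hb m j
  obtain ⟨d, hd, h'⟩ := qFactorial_add_sub_mem (O := O) hb (m + j) j
  have hm := qFactorial_ne_zero hb1 m
  have hj := qFactorial_ne_zero hb1 (m + j)
  have h2j := qFactorial_ne_zero hb1 (m + 2 * j)
  rw [two_mul, ← add_assoc] at *
  have hu : 1 + b ^ (m + j + 1) * d ≠ 0 := fun h0 => h2j (by rw [h', h0, mul_zero])
  have hinv : (1 + b ^ (m + j + 1) * d)⁻¹ ∈ O := by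
    have : (1 + b ^ (m + j + 1) * d)⁻¹ = qFactorial b (m + j) * (qFactorial b (m + j + j))⁻¹ := by
      rw [h']
      field_simp
    rw [this]
    exact mul_mem (qFactorial_mem hb _) (qFactorial_inv_mem hbO _)
  refine ⟨(c - b ^ j * d) * (1 + b ^ (m + j + 1) * d)⁻¹,
    mul_mem (sub_mem hc (mul_mem (pow_mem hb _) hd)) hinv, ?_⟩
  rw [h', sq]
  field_simp
  rw [h]
  field_simp
  ring

theorem qRecip_ratio {b : K} {N : ℕ} {r : ℤ} (h : r.natAbs ≤ N) :
    qRecip b (N - r) * qRecip b (N + r) =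
      (qFactorial b (N - r.natAbs))⁻¹ * (qFactorial b (N - r.natAbs + 2 * r.natAbs))⁻¹ := by
  rw [← qRecip_natCast, ← qRecip_natCast]
  rcases Int.natAbs_eq r with hr | hr
  · congr 2 <;> omega
  · rw [mul_comm]
    congr 2 <;> omega

theorem qRecip_mul_eq_zero {b : K} {N : ℕ} {r : ℤ} (h : N < r.natAbs) :
    qRecip b (N - r) * qRecip b (N + r) = 0 := by
  rcases Int.natAbs_eq r with hr | hr
  · rw [qRecip_of_neg b (show (N - r : ℤ) < 0 by omega), zero_mul]
  · rw [qRecip_of_neg b (show (N + r : ℤ) < 0 by omega), mul_zero]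

/-- x / (1 - x)² is invariant under x ↦ 1/x. This exposes the factor b^|r| on which the congruence
rests. -/
theorem zpow_div_one_sub_sq {b : K} (hb : b ≠ 0) (r : ℤ) :
    b ^ r / (1 - b ^ r) ^ 2 = b ^ r.natAbs * (1 - b ^ r.natAbs)⁻¹ ^ 2 := by
  rw [inv_pow, ← div_eq_mul_inv]
  rcases Int.natAbs_eq r with hr | hr
  · have : b ^ r = b ^ r.natAbs := by rw [← zpow_natCast, ← hr]
    rw [this]
  · have : b ^ r = (b ^ r.natAbs)⁻¹ := by rw [← zpow_natCast, ← zpow_neg, ← hr]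
    rw [this]
    have hx : b ^ r.natAbs ≠ 0 := pow_ne_zero _ hb
    generalize b ^ r.natAbs = x at *
    rw [show 1 - x⁻¹ = -(1 - x) * x⁻¹ by field_simp; ring, mul_pow, neg_sq, inv_pow]
    field_simp

theorem zpow_mem_of_nonneg (hq : q ∈ O) {k : ℤ} (hk : 0 ≤ k) : q ^ k ∈ O := by
  lift k to ℕ using hk
  rw [zpow_natCast]
  exact pow_mem hq k

theorem neg_one_zpow_mem (r : ℤ) : (-1 : K) ^ r ∈ O := by
  rcases Int.even_or_odd r with h | h
  · rw [h.neg_one_zpow]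
    exact one_mem O
  · rw [h.neg_one_zpow]
    exact neg_mem (one_mem O)

/-- After expanding 1 + q^(2r), the exponents are 3r² ± r and r² ± r, all nonnegative. -/
theorem pairDiff_mem (hq0 : q ≠ 0) (hq : q ∈ O) (r : ℤ) : pairDiff q r ∈ O := by
  have h1 : 0 ≤ r * (r - 1) := by
    rcases le_or_gt r 0 with h | h <;> nlinarith
  have h2 : 0 ≤ r * (r + 1) := by
    rcases lt_or_ge r 0 with h | h <;> nlinarith
  have h3 : pairDiff q r = (-1) ^ r * (q ^ (r * (3 * r - 1)) + q ^ (r * (3 * r - 1) + 2 * r)) -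
      (-1) ^ r * (q ^ (r * (r - 1)) + q ^ (r * (r - 1) + 2 * r)) := by
    rw [pairDiff, pentCoeff, triCoeff, zpow_add₀ hq0, zpow_add₀ hq0]
    ring
  rw [h3]
  refine sub_mem (mul_mem (neg_one_zpow_mem r) (add_mem ?_ ?_))
    (mul_mem (neg_one_zpow_mem r) (add_mem ?_ ?_)) <;> refine zpow_mem_of_nonneg hq ?_ <;> nlinarith

theorem two_mul_sum_slater (hq : q ≠ 0) (hq1 : ∀ k : ℕ, 0 < k → q ^ k ≠ 1) (N : ℕ) :
    2 * ∑ n ∈ range N, q ^ (n + 1) * qFactorial q n ^ 2 *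
        ((1 - q ^ (n + 1).choose 2) * slaterBeta q (n + 1)) =
      symmSum (N + 1) (fun r => pairDiff q r * (q ^ (2 * r) / (1 - q ^ (2 * r)) ^ 2 *
        (qFactorial q N ^ 2 * (qRecip q (N - 2 * r) * qRecip q (N + 2 * r))))) := by
  refine two_mul_sum_eq_of_bailey hq hq1 two_pos (pairDiff_zero q)
    (β := fun n => (1 - q ^ n.choose 2) * slaterBeta q n) fun n hn => ?_
  have h1 := symmSum_pentCoeff hq hq1 (n := n + 1) (M := N + 1) (by omega)
  have h2 := symmSum_triCoeff hq hq1 (n := n + 1) (M := N + 1) (by omega)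
  rw [sub_mul, one_mul, mul_sub, ← h1, ← h2, ← symmSum_sub]
  exact symmSum_congr _ fun r => by rw [pairDiff]; ring

/-- The `triCoeff` pair has β_n = 0 for n > 0, so subtracting it leaves the left side unchanged. -/
theorem two_mul_sum_euler (hq : q ≠ 0) (hq1 : ∀ k : ℕ, 0 < k → q ^ k ≠ 1) (N : ℕ) :
    2 * ∑ n ∈ range N, (q ^ 2) ^ (n + 1) * qFactorial (q ^ 2) n ^ 2 *
        (qFactorial (q ^ 2) (n + 1))⁻¹ =
      symmSum (N + 1) (fun r => pairDiff q r * (q ^ (2 * r) / (1 - q ^ (2 * r)) ^ 2 *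
        (qFactorial (q ^ 2) N ^ 2 * (qRecip (q ^ 2) (N - r) * qRecip (q ^ 2) (N + r))))) := by
  have h := two_mul_sum_eq_of_bailey (pow_ne_zero 2 hq) (sq_pow_ne_one hq1) (N := N) (M := N + 1)
    one_pos (pairDiff_zero q) (β := fun n => (qFactorial (q ^ 2) n)⁻¹) fun n hn => ?_
  · simp only [one_mul, sq_zpow] at h
    simpa only [zpow_two_mul] using h
  · have h1 := symmSum_pentCoeff_sq hq hq1 (n := n + 1) (M := N + 1) (by omega)
    have h2 := symmSum_triCoeff_sq hq hq1 (n := n + 1) (M := N + 1) (by omega) (by omega)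
    rw [← div_eq_mul_inv, ← h1]
    refine Eq.trans ?_ (sub_zero _)
    rw [← h2, ← symmSum_sub]
    exact symmSum_congr _ fun r => by rw [pairDiff, one_mul]; ring

/-- The two Bailey sums agree modulo `q ^ (N + 1)`. -/
theorem sum_slater_sub_sum_euler_mem (hq : q ≠ 0) (hq1 : ∀ k : ℕ, 0 < k → q ^ k ≠ 1)
    (hqO : q ∈ O) (hinv : ∀ k : ℕ, 0 < k → (1 - q ^ k)⁻¹ ∈ O) (N : ℕ) :
    ∃ c ∈ O, 2 * ∑ n ∈ range N, q ^ (n + 1) * qFactorial q n ^ 2 *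
        ((1 - q ^ (n + 1).choose 2) * slaterBeta q (n + 1)) -
      2 * ∑ n ∈ range N, (q ^ 2) ^ (n + 1) * qFactorial (q ^ 2) n ^ 2 *
        (qFactorial (q ^ 2) (n + 1))⁻¹ = q ^ (N + 1) * c := by
  rw [two_mul_sum_slater hq hq1, two_mul_sum_euler hq hq1, ← symmSum_sub]
  have hp1 := sq_pow_ne_one hq1
  have hpinv : ∀ k : ℕ, 0 < k → (1 - (q ^ 2) ^ k)⁻¹ ∈ O := fun k hk => by
    rw [← pow_mul]
    exact hinv _ (by omega)
  have key : ∀ r : ℤ, ∃ c ∈ O, pairDiff q r * (q ^ (2 * r) / (1 - q ^ (2 * r)) ^ 2 *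
        (qFactorial q N ^ 2 * (qRecip q (N - 2 * r) * qRecip q (N + 2 * r)))) -
      pairDiff q r * (q ^ (2 * r) / (1 - q ^ (2 * r)) ^ 2 *
        (qFactorial (q ^ 2) N ^ 2 * (qRecip (q ^ 2) (N - r) * qRecip (q ^ 2) (N + r)))) =
      q ^ (N + 1) * c := by
    intro r
    rcases eq_or_ne r 0 with rfl | hr
    · exact ⟨0, zero_mem O, by simp [pairDiff_zero]⟩
    set j := r.natAbs with hj
    have hj0 : 0 < j := Int.natAbs_pos.2 hr
    have h2r : (2 * r).natAbs = 2 * j := by omega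
    rw [zpow_div_one_sub_sq hq, h2r]
    have hw : pairDiff q r * ((1 - q ^ (2 * j))⁻¹) ^ 2 ∈ O :=
      mul_mem (pairDiff_mem hq hqO r) (pow_mem (hinv _ (by omega)) 2)
    generalize (1 - q ^ (2 * j))⁻¹ = w at hw ⊢
    have hv : ∃ c ∈ O, j ≤ N → qFactorial (q ^ 2) N ^ 2 *
        (qRecip (q ^ 2) (N - r) * qRecip (q ^ 2) (N + r)) = 1 + (q ^ 2) ^ (N - j + 1) * c := by
      by_cases hjN : j ≤ N
      · obtain ⟨c, hc, h⟩ := qFactorial_ratio_sub_one_mem (pow_mem hqO 2) hp1 hpinv (N - j) j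
        refine ⟨c, hc, fun _ => ?_⟩
        rw [qRecip_ratio hjN, ← h, Nat.sub_add_cancel hjN]
      · exact ⟨0, zero_mem O, fun h => absurd h hjN⟩
    obtain ⟨c, hc, hv⟩ := hv
    -- The weight supplies q^(2j). The factorial ratios are 1 modulo q^(N-2j+1) in base q and modulo
    -- q^(2(N-j+1)) in base q², so the difference is divisible by q^(N+1).
    by_cases h2j : 2 * j ≤ N
    · obtain ⟨d, hd, h⟩ := qFactorial_ratio_sub_one_mem hqO hq1 hinv (N - 2 * j) (2 * j)
      rw [hv (by omega), qRecip_ratio (r := 2 * r) (by omega), h2r]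
      rw [Nat.sub_add_cancel h2j] at h
      rw [h]
      refine ⟨pairDiff q r * w ^ 2 * (d - q ^ (N + 1) * c),
        mul_mem hw (sub_mem hd (mul_mem (pow_mem hqO _) hc)), ?_⟩
      obtain ⟨m, rfl⟩ := Nat.exists_eq_add_of_le h2j
      rw [show 2 * j + m - 2 * j = m by omega, show 2 * j + m - j = j + m by omega]
      ring
    -- Here 2j > N: the base q term vanishes, and q^(2j) alone is already divisible by q^(N+1).
    · rw [qRecip_mul_eq_zero (r := 2 * r) (by omega)]
      obtain ⟨m, hm⟩ := Nat.exists_eq_add_of_lt (not_le.1 h2j)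
      by_cases hjN : j ≤ N
      · rw [hv hjN]
        refine ⟨-(pairDiff q r * w ^ 2 * (q ^ m *
          (1 + (q ^ 2) ^ (N - j + 1) * c))), neg_mem (mul_mem hw (mul_mem (pow_mem hqO _)
          (add_mem (one_mem O) (mul_mem (pow_mem (pow_mem hqO 2) _) hc)))), ?_⟩
        rw [hm]
        ring
      · rw [qRecip_mul_eq_zero (r := r) (by omega)]
        exact ⟨0, zero_mem O, by ring⟩
  choose c hc h using key
  refine ⟨symmSum (N + 1) c, sum_mem fun i _ => hc _, ?_⟩
  rw [symmSum_congr _ h, ← mul_symmSum]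

end Congruence

/-! ### Partitions weighted by the multiplicity of one part -/

section GeneratingFunctions

open PowerSeries
open scoped PowerSeries.WithPiTopology

theorem genFun_eq_prod {R : Type*} [CommSemiring R] [TopologicalSpace R] [T2Space R]
    (f : ℕ → ℕ → R) {V : Finset ℕ} (hV : 0 ∉ V) (hf : ∀ i ∉ V, ∀ c, f i c = 0) :
    Nat.Partition.genFun f =
      ∏ i ∈ V, (1 + ∑' j, f i (j + 1) • (X : R⟦X⟧) ^ (i * (j + 1))) := by
  -- The infinite product for `genFun` is indexed from 0, with index i standing for the part i + 1.
  have hinj : Set.InjOn (fun i : ℕ => i - 1) V := fun i hi j hj h => by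
    have hi0 : i ≠ 0 := fun h => hV (h ▸ hi)
    have hj0 : j ≠ 0 := fun h => hV (h ▸ hj)
    simp only at h
    omega
  rw [Nat.Partition.genFun_eq_tprod, tprod_eq_prod (s := V.image (fun i => i - 1)),
    prod_image hinj]
  · refine prod_congr rfl fun i hi => ?_
    have hi0 : i ≠ 0 := fun h => hV (h ▸ hi)
    rw [Nat.sub_add_cancel (Nat.one_le_iff_ne_zero.2 hi0)]
  · intro i hi
    have : i + 1 ∉ V := fun h => hi (mem_image.2 ⟨i + 1, h, rfl⟩)
    simp [hf _ this]

theorem one_add_tsum_geometric {i : ℕ} (hi : i ≠ 0) :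
    (1 + ∑' j, (1 : ℚ) • (X : ℚ⟦X⟧) ^ (i * (j + 1))) * (1 - X ^ i) = 1 := by
  have hs := Nat.Partition.summable_genFun_term' (fun _ _ => (1 : ℚ)) hi
  have h := hs.tsum_eq_zero_add
  have h2 : ∑' j, (1 : ℚ) • (X : ℚ⟦X⟧) ^ (i * (j + 1 + 1)) =
      X ^ i * ∑' j, (1 : ℚ) • (X : ℚ⟦X⟧) ^ (i * (j + 1)) := by
    rw [← hs.tsum_mul_left]
    exact tsum_congr fun j => by rw [one_smul, one_smul]; ring
  rw [h2, zero_add, mul_one, one_smul] at h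
  linear_combination h

theorem tsum_arithmetic_geometric {i : ℕ} (hi : i ≠ 0) :
    (∑' j, ((j + 1 : ℕ) : ℚ) • (X : ℚ⟦X⟧) ^ (i * (j + 1))) * (1 - X ^ i) ^ 2 = X ^ i := by
  have hs := Nat.Partition.summable_genFun_term' (fun _ c => (c : ℚ)) hi
  have hs1 := Nat.Partition.summable_genFun_term' (fun _ _ => (1 : ℚ)) hi
  have h := hs.tsum_eq_zero_add
  have h2 : ∑' j, ((j + 1 + 1 : ℕ) : ℚ) • (X : ℚ⟦X⟧) ^ (i * (j + 1 + 1)) =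
      X ^ i * ∑' j, ((j + 1 : ℕ) : ℚ) • (X : ℚ⟦X⟧) ^ (i * (j + 1)) +
      X ^ i * ∑' j, (1 : ℚ) • (X : ℚ⟦X⟧) ^ (i * (j + 1)) := by
    rw [← hs.tsum_mul_left, ← hs1.tsum_mul_left, ← (hs.mul_left _).tsum_add (hs1.mul_left _)]
    refine tsum_congr fun j => ?_
    rw [Nat.cast_succ, add_smul, mul_add i (j + 1) 1, mul_one, pow_add, mul_smul_comm,
      mul_smul_comm, mul_comm (X ^ i)]
  rw [h2, zero_add, mul_one, Nat.cast_one, one_smul] at h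
  have h3 := one_add_tsum_geometric hi
  linear_combination (1 - X ^ i) * h + X ^ i * h3

/-- The weight of `c` occurrences of the part `i`: the part `s` has the weight `t c`, the parts in
`U` have weight one, and no other parts are allowed. -/
def partWeight (s : ℕ) (U : Finset ℕ) (t : ℕ → ℚ) (i c : ℕ) : ℚ :=
  if i = s then t c else if i ∈ U then 1 else 0

/-- The generating function of the partitions that contain `s` and have all other parts in `U`,
weighted by the number of occurrences of `s`. -/
noncomputable def countGenFun (s : ℕ) (U : Finset ℕ) : ℚ⟦X⟧ :=
  Nat.Partition.genFun (partWeight s U fun c => c) - Nat.Partition.genFun (partWeight s U fun _ => 0)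

theorem genFun_partWeight {s : ℕ} (hs : s ≠ 0) {U : Finset ℕ} (hU : 0 ∉ U) (hsU : s ∉ U)
    (t : ℕ → ℚ) :
    Nat.Partition.genFun (partWeight s U t) * ∏ i ∈ U, (1 - X ^ i) =
      1 + ∑' j, t (j + 1) • (X : ℚ⟦X⟧) ^ (s * (j + 1)) := by
  rw [genFun_eq_prod (V := insert s U), prod_insert hsU, mul_assoc, ← prod_mul_distrib,
    prod_eq_one, mul_one]
  · simp [partWeight]
  · intro i hi
    have his : i ≠ s := fun h => hsU (h ▸ hi)
    have hi0 : i ≠ 0 := fun h => hU (h ▸ hi)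
    simpa [partWeight, his, hi] using one_add_tsum_geometric hi0
  · simp [hU, hs.symm]
  · intro i hi c
    simp only [mem_insert, not_or] at hi
    simp [partWeight, hi]

theorem countGenFun_mul {s : ℕ} (hs : s ≠ 0) {U : Finset ℕ} (hU : 0 ∉ U) (hsU : s ∉ U) :
    countGenFun s U * ((1 - X ^ s) ^ 2 * ∏ i ∈ U, (1 - X ^ i)) = X ^ s := by
  have h1 := genFun_partWeight hs hU hsU fun c => c
  have h2 := genFun_partWeight hs hU hsU fun _ => 0
  have h3 := tsum_arithmetic_geometric hs
  simp only [zero_smul, tsum_zero] at h2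
  rw [countGenFun]
  linear_combination (1 - X ^ s) ^ 2 * (h1 - h2) + h3

/-- Only parts that occur enter the product in `genFun`. A partition without s thus has the same
weight in both series and cancels, while one containing s has weight 0 in the second. -/
theorem coeff_countGenFun (s : ℕ) (U : Finset ℕ) (n : ℕ) :
    coeff n (countGenFun s U) = ∑ p : n.Partition,
      if s ∈ p.parts ∧ ∀ i ∈ p.parts, i ∈ insert s U then (p.parts.count s : ℚ) else 0 := by
  rw [countGenFun, map_sub, Nat.Partition.coeff_genFun, Nat.Partition.coeff_genFun,
    ← sum_sub_distrib]
  refine sum_congr rfl fun p _ => ?_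
  simp only [Finsupp.prod, Multiset.toFinsupp_support, Multiset.toFinsupp_apply]
  by_cases hU : ∀ i ∈ p.parts, i ∈ insert s U
  · have hone : ∀ t : ℕ → ℚ, ∀ i ∈ p.parts.toFinset.erase s,
        partWeight s U t i (p.parts.count i) = 1 := fun t i hi => by
      have hi' := mem_erase.1 hi
      have := (mem_insert.1 (hU i (Multiset.mem_toFinset.1 hi'.2))).resolve_left hi'.1
      simp [partWeight, hi'.1, this]
    by_cases hs : s ∈ p.parts
    · rw [if_pos ⟨hs, hU⟩, ← mul_prod_erase _ _ (Multiset.mem_toFinset.2 hs),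
        ← mul_prod_erase _ _ (Multiset.mem_toFinset.2 hs), prod_congr rfl (hone _),
        prod_congr rfl (hone _)]
      simp [partWeight]
    · have herase : p.parts.toFinset.erase s = p.parts.toFinset :=
        erase_eq_of_notMem (by simpa using hs)
      rw [if_neg (fun h => hs h.1), ← herase, prod_congr rfl (hone _), prod_congr rfl (hone _),
        sub_self]
  · rw [if_neg (fun h => hU h.2)]
    push Not at hU
    obtain ⟨i, hi, hiU⟩ := hU
    simp only [mem_insert, not_or] at hiU
    rw [prod_eq_zero (Multiset.mem_toFinset.2 hi), prod_eq_zero (Multiset.mem_toFinset.2 hi),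
      sub_self] <;> simp [partWeight, hiU]

end GeneratingFunctions

/-! ### The three counts as coefficients of power series -/

section SmallestPart

variable {n : ℕ}

theorem smallestPart_mem {π : n.Partition} (h : π.parts ≠ 0) : smallestPart π ∈ π.parts := by
  have hne : π.parts.toFinset.Nonempty := by simpa using h
  rw [smallestPart, ← coe_min' hne, WithTop.untopD_coe]
  exact Multiset.mem_toFinset.1 (min'_mem _ _)

theorem smallestPart_le {π : n.Partition} {i : ℕ} (h : i ∈ π.parts) : smallestPart π ≤ i := by
  have hi := Multiset.mem_toFinset.2 h
  rw [smallestPart, ← coe_min' ⟨i, hi⟩, WithTop.untopD_coe]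
  exact min'_le _ _ hi

theorem smallestPart_eq_iff {π : n.Partition} {s : ℕ} (hs : 0 < s) :
    smallestPart π = s ↔ s ∈ π.parts ∧ ∀ i ∈ π.parts, s ≤ i := by
  constructor
  · rintro rfl
    refine ⟨smallestPart_mem fun h => ?_, fun i => smallestPart_le⟩
    simp [smallestPart, h] at hs
  · rintro ⟨h1, h2⟩
    exact (smallestPart_le h1).antisymm (h2 _ (smallestPart_mem fun h => by simp [h] at h1))

theorem le_of_mem_parts {π : n.Partition} {i : ℕ} (h : i ∈ π.parts) : i ≤ n := by
  rw [← π.parts_sum]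
  exact Multiset.le_sum_of_mem h

/-- A sum over partitions, weighted by the number of smallest parts, splits according to the
smallest part. -/
theorem sum_smallestCount_mul (P : n.Partition → Prop) [DecidablePred P] (g : ℕ → ℚ)
    (U : ℕ → Finset ℕ) {L : ℕ} (hL : n ≤ L) (hU : ∀ s, ∀ i ∈ U s, s < i)
    (hP : ∀ π : n.Partition, P π ↔ ∀ i ∈ π.parts, smallestPart π < i → i ∈ U (smallestPart π)) :
    ∑ π : n.Partition with P π, (smallestCount π : ℚ) * g (smallestPart π) =
      ∑ k ∈ range L, g (k + 1) * PowerSeries.coeff n (countGenFun (k + 1) (U (k + 1))) := by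
  have hcoeff : ∀ k, PowerSeries.coeff n (countGenFun (k + 1) (U (k + 1))) =
      ∑ π : n.Partition with P π, if smallestPart π = k + 1 then (smallestCount π : ℚ) else 0 := by
    intro k
    rw [coeff_countGenFun, sum_filter]
    refine sum_congr rfl fun π _ => ?_
    rw [← ite_and]
    have hiff : ((k + 1) ∈ π.parts ∧ ∀ i ∈ π.parts, i ∈ insert (k + 1) (U (k + 1))) ↔
        P π ∧ smallestPart π = k + 1 := by
      rw [hP]
      constructor
      · rintro ⟨h1, h2⟩
        have hs : smallestPart π = k + 1 := by
          refine (smallestPart_eq_iff k.succ_pos).2 ⟨h1, fun i hi => ?_⟩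
          rcases mem_insert.1 (h2 i hi) with h | h
          · exact h.ge
          · exact (hU _ i h).le
        refine ⟨fun i hi hlt => ?_, hs⟩
        rw [hs] at hlt ⊢
        exact (mem_insert.1 (h2 i hi)).resolve_left hlt.ne'
      · rintro ⟨h1, hs⟩
        rw [hs] at h1
        obtain ⟨h2, h3⟩ := (smallestPart_eq_iff k.succ_pos).1 hs
        refine ⟨h2, fun i hi => mem_insert.2 ?_⟩
        rcases (h3 i hi).eq_or_lt with h | h
        · exact Or.inl h.symm
        · exact Or.inr (h1 i hi h)
    by_cases h : P π ∧ smallestPart π = k + 1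
    · rw [if_pos (hiff.2 h), if_pos h, smallestCount, h.2]
    · rw [if_neg (fun h' => h (hiff.1 h')), if_neg h]
  simp only [hcoeff, mul_sum]
  rw [sum_comm]
  refine sum_congr rfl fun π _ => ?_
  by_cases hπ : π.parts = 0
  · simp [smallestCount, hπ]
  · have hmem := smallestPart_mem hπ
    have hpos := π.parts_pos hmem
    have hle := le_of_mem_parts hmem
    rw [sum_eq_single (smallestPart π - 1), Nat.sub_add_cancel hpos, if_pos rfl, mul_comm]
    · intro k _ hk
      rw [if_neg (by omega), mul_zero]
    · intro h
      exact absurd (mem_range.2 (by omega)) h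

theorem card_isTriangular (b l : ℕ) :
    #{δ : b.Partition | IsTriangular l δ} = if b = l.choose 2 then 1 else 0 := by
  have hsum : (Ico 1 l).val.sum = l.choose 2 := by
    rw [sum_val, Nat.choose_two_right, ← sum_range_id]
    refine sum_subset (fun i hi => ?_) fun i hi hi' => ?_
    · simp only [mem_Ico, mem_range] at *
      omega
    · simp only [mem_Ico, mem_range, id] at *
      omega
  split_ifs with h
  · rw [card_eq_one]
    refine ⟨⟨(Ico 1 l).val, fun {i} hi => ?_, hsum.trans h.symm⟩, ?_⟩
    · exact (mem_Ico.1 (show i ∈ Ico 1 l from hi)).1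
    · ext δ
      rw [mem_filter, mem_singleton]
      exact ⟨fun h => Nat.Partition.ext h.2, fun h => ⟨mem_univ _, congrArg _ h⟩⟩
  · rw [card_eq_zero, filter_eq_empty_iff]
    intro δ _ hδ
    exact h (by rw [← hsum, ← hδ, δ.parts_sum])

/-- The parts greater than `s` that may occur in a partition with smallest part `s` without odd
parts greater than `2 s`, even parts being bounded by `2 L`. -/
def oddRestricted (L s : ℕ) : Finset ℕ :=
  Ioc s (2 * s) ∪ (Ioc s L).image (2 * ·)

theorem lt_of_mem_oddRestricted {L s i : ℕ} (h : i ∈ oddRestricted L s) : s < i := by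
  simp only [oddRestricted, mem_union, mem_Ioc, mem_image] at h
  omega

/-- Parts up to 2s are free and larger ones must be even. The bound 2L exceeds what size n requires,
but makes the even parts contribute exactly (q²)_L / (q²)_s. -/
theorem noLargeOdd_iff {L : ℕ} (hL : n ≤ L) (π : n.Partition) :
    NoLargeOdd π ↔
      ∀ i ∈ π.parts, smallestPart π < i → i ∈ oddRestricted L (smallestPart π) := by
  refine forall₂_congr fun i hi => ?_
  have := le_of_mem_parts hi
  have := smallestPart_le hi
  simp only [oddRestricted, mem_union, mem_Ioc, mem_image]
  constructor
  · intro h hlt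
    rcases Nat.even_or_odd' i with ⟨j, hj | hj⟩
    · by_cases h2 : i ≤ 2 * smallestPart π
      · exact Or.inl ⟨hlt, h2⟩
      · exact Or.inr ⟨j, by omega, hj.symm⟩
    · exact Or.inl ⟨hlt, h ⟨j, hj⟩⟩
  · rintro h ⟨j, hj⟩
    by_contra h2
    rcases h (by omega) with h | ⟨k, _, hk⟩ <;> omega

theorem spt_eq_coeff {L : ℕ} (hL : n ≤ L) :
    (spt n : ℚ) = PowerSeries.coeff n (∑ k ∈ range L, countGenFun (k + 1) (Ioc (k + 1) L)) := by
  have h := sum_smallestCount_mul (n := n) (fun _ => True) (fun _ => 1) (fun s => Ioc s L) hL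
    (fun s i hi => (mem_Ioc.1 hi).1) fun π => ?_
  · rw [map_sum, spt, Nat.cast_sum]
    simpa using h
  · simp only [true_iff]
    exact fun i hi hlt => mem_Ioc.2 ⟨hlt, (le_of_mem_parts hi).trans hL⟩

theorem sptOPlus_eq_coeff {L : ℕ} (hL : n ≤ L) :
    (sptOPlus n : ℚ) = PowerSeries.coeff n
      (∑ k ∈ range L, countGenFun (k + 1) (oddRestricted L (k + 1))) := by
  have h := sum_smallestCount_mul (n := n) NoLargeOdd (fun _ => 1) (oddRestricted L) hL
    (fun s i => lt_of_mem_oddRestricted) (noLargeOdd_iff hL)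
  rw [map_sum, sptOPlus, Nat.cast_sum]
  simpa using h

/-- Given s, the triangular partition is unique and has size `s.choose 2`, so pairing with it
multiplies the series by a single power of X. -/
theorem sptOMinus_eq_coeff {L : ℕ} (hL : n ≤ L) :
    (sptOMinus n : ℚ) = PowerSeries.coeff n
      (∑ k ∈ range L, countGenFun (k + 1) (oddRestricted L (k + 1)) *
        PowerSeries.X ^ (k + 1).choose 2) := by
  rw [map_sum]
  simp only [PowerSeries.coeff_mul, PowerSeries.coeff_X_pow]
  rw [sum_comm, sptOMinus, Nat.cast_sum]
  refine sum_congr rfl fun ab hab => ?_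
  have hle : ab.1 ≤ L := by
    have := mem_antidiagonal.1 hab
    omega
  have h := sum_smallestCount_mul (n := ab.1) NoLargeOdd
    (fun s => if ab.2 = s.choose 2 then 1 else 0) (oddRestricted L) hle
    (fun s i => lt_of_mem_oddRestricted) (noLargeOdd_iff hle)
  simp only [mul_comm (PowerSeries.coeff _ _)]
  rw [← h, Nat.cast_sum, sum_filter, Fintype.sum_prod_type, sum_filter]
  refine sum_congr rfl fun π _ => ?_
  by_cases hπ : NoLargeOdd π
  · have hc := card_isTriangular ab.2 (smallestPart π)
    simp only [hπ, true_and, if_true]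
    rw [← sum_filter, sum_const, hc]
    split_ifs <;> simp
  · simp [hπ]

end SmallestPart

open PowerSeries

theorem qFactorial_mul_prod_Ioc {R : Type*} [CommRing R] (b : R) {s L : ℕ} (h : s ≤ L) :
    qFactorial b s * ∏ i ∈ Ioc s L, (1 - b ^ i) = qFactorial b L := by
  induction L, h using Nat.le_induction with
  | base => simp
  | succ L hL ih => rw [← insert_Ioc_right_eq_Ioc_add_one hL, prod_insert (by simp),
      qFactorial_succ, ← ih]; ring

theorem constantCoeff_qFactorial (k n : ℕ) (hk : k ≠ 0) :
    constantCoeff (qFactorial ((X : ℚ⟦X⟧) ^ k) n) = 1 := by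
  rw [qFactorial, map_prod]
  exact prod_eq_one fun i _ => by simp [hk]

theorem map_qFactorial {R S : Type*} [CommRing R] [CommRing S] (φ : R →+* S) (b : R) (n : ℕ) :
    φ (qFactorial b n) = qFactorial (φ b) n := by
  simp [qFactorial]

/-! ### Transfer to a field containing the power series -/

section Transfer

variable {K : Type*} [Field K] {φ : ℚ⟦X⟧ →+* K}

theorem map_X_ne_zero (hφ : Function.Injective φ) : φ X ≠ 0 :=
  (map_ne_zero_iff φ hφ).2 X_ne_zero

theorem map_X_pow_ne_one (hφ : Function.Injective φ) (k : ℕ) (hk : 0 < k) : φ X ^ k ≠ 1 := by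
  rw [← map_pow, ← map_one φ]
  intro h
  have := congrArg constantCoeff (hφ h)
  simp [hk.ne'] at this

theorem map_X_sq_pow_ne_one (hφ : Function.Injective φ) (k : ℕ) (hk : 0 < k) :
    (φ X ^ 2) ^ k ≠ 1 :=
  sq_pow_ne_one (map_X_pow_ne_one hφ) k hk

theorem inv_one_sub_map_X_pow_mem_range (k : ℕ) (hk : 0 < k) : (1 - φ X ^ k)⁻¹ ∈ φ.range := by
  have h : (1 - X ^ k : ℚ⟦X⟧) * (1 - X ^ k)⁻¹ = 1 := PowerSeries.mul_inv_cancel _ (by simp [hk.ne'])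
  refine ⟨(1 - X ^ k)⁻¹, eq_inv_of_mul_eq_one_right ?_⟩
  simpa using congrArg φ h

/-- A smallest part contributes `q ^ s (q; q)_{s-1} / (1 - q ^ s)` to the spt function. -/
theorem map_expand_countGenFun_mul (hφ : Function.Injective φ) {L n : ℕ} (hn : n < L) :
    φ (expand 2 two_ne_zero (countGenFun (n + 1) (Ioc (n + 1) L))) * qFactorial (φ X ^ 2) L =
      (φ X ^ 2) ^ (n + 1) * qFactorial (φ X ^ 2) n ^ 2 * (qFactorial (φ X ^ 2) (n + 1))⁻¹ := by
  have hp1 := map_X_sq_pow_ne_one hφ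
  have h := congrArg φ (congrArg (expand 2 two_ne_zero)
    (countGenFun_mul (s := n + 1) (U := Ioc (n + 1) L) (by omega) (by simp) (by simp)))
  simp only [map_mul, map_pow, map_sub, map_one, map_prod, expand_X] at h
  rw [← qFactorial_mul_prod_Ioc (φ X ^ 2) (show n + 1 ≤ L from hn), qFactorial_succ]
  have h1 := sub_ne_zero.2 (hp1 (n + 1) n.succ_pos).symm
  have h2 := qFactorial_ne_zero hp1 n
  rw [eq_mul_inv_iff_mul_eq₀ (mul_ne_zero h2 h1)]
  linear_combination qFactorial (φ X ^ 2) n ^ 2 * h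

/-- A smallest part contributes `q ^ s (q; q)_{s-1}² / ((q; q)_s (q; q²)_s)` to the restricted spt
function. -/
theorem map_countGenFun_mul (hφ : Function.Injective φ) {L n : ℕ} (hn : n < L) :
    φ (countGenFun (n + 1) (oddRestricted L (n + 1))) * qFactorial (φ X ^ 2) L =
      φ X ^ (n + 1) * qFactorial (φ X) n ^ 2 * slaterBeta (φ X) (n + 1) := by
  have hq1 := map_X_pow_ne_one hφ
  have h := congrArg φ (countGenFun_mul (s := n + 1) (U := oddRestricted L (n + 1)) (by omega)
    (fun h => absurd (lt_of_mem_oddRestricted h) (by omega))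
    (fun h => absurd (lt_of_mem_oddRestricted h) (by omega)))
  have hdisj : Disjoint (Ioc (n + 1) (2 * (n + 1))) ((Ioc (n + 1) L).image (2 * ·)) := by
    rw [disjoint_left]
    intro i hi hi'
    simp only [mem_Ioc, mem_image] at hi hi'
    omega
  rw [oddRestricted, prod_union hdisj, prod_image (fun i _ j _ h => by simpa using h)] at h
  simp only [map_mul, map_pow, map_sub, map_one, map_prod, pow_mul] at h
  rw [← oddRestricted] at h
  have h3 := qFactorial_mul_prod_Ioc (φ X) (show n + 1 ≤ 2 * (n + 1) by omega)
  have h4 := qFactorial_ne_zero hq1 (n + 1)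
  have h5 := qFactorial_ne_zero hq1 (2 * (n + 1))
  have h1 := sub_ne_zero.2 (hq1 (n + 1) n.succ_pos).symm
  have h2 := qFactorial_ne_zero hq1 n
  rw [← qFactorial_mul_prod_Ioc (φ X ^ 2) (show n + 1 ≤ L from hn), slaterBeta]
  rw [← h3] at h5 ⊢
  rw [← h, qFactorial_succ (φ X)]
  rw [qFactorial_succ] at h5
  have h6 := right_ne_zero_of_mul h5
  field_simp

/-- Two power series that yield the two Bailey sums agree to high order. -/
theorem X_pow_dvd_sub_of_bailey (hφ : Function.Injective φ) {L : ℕ} {A B : ℚ⟦X⟧}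
    (hA : φ A * qFactorial (φ X ^ 2) L = ∑ n ∈ range L, φ X ^ (n + 1) * qFactorial (φ X) n ^ 2 *
        ((1 - φ X ^ (n + 1).choose 2) * slaterBeta (φ X) (n + 1)))
    (hB : φ B * qFactorial (φ X ^ 2) L = ∑ n ∈ range L, (φ X ^ 2) ^ (n + 1) *
        qFactorial (φ X ^ 2) n ^ 2 * (qFactorial (φ X ^ 2) (n + 1))⁻¹) :
    X ^ (L + 1) ∣ A - B := by
  obtain ⟨c, ⟨c, rfl⟩, h⟩ := sum_slater_sub_sum_euler_mem (O := φ.range) (map_X_ne_zero hφ)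
    (map_X_pow_ne_one hφ) ⟨X, rfl⟩ inv_one_sub_map_X_pow_mem_range L
  rw [← hA, ← hB, ← map_pow, ← map_qFactorial, ← map_ofNat φ 2, ← map_mul, ← map_mul, ← map_mul,
    ← map_mul, ← map_sub, ← map_pow, ← map_mul] at h
  have h' := hφ h
  -- The constant term is 2, invertible over ℚ, so the doubling and the common denominator can be
  -- divided out.
  have hunit : IsUnit (2 * qFactorial ((X : ℚ⟦X⟧) ^ 2) L) := by
    rw [isUnit_iff_constantCoeff, map_mul, constantCoeff_qFactorial 2 L two_ne_zero, map_ofNat]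
    norm_num
  rw [← hunit.dvd_mul_right]
  exact ⟨c, by rw [← h']; ring⟩

end Transfer

theorem sptO_two_mul (n : ℕ) : sptO (2 * n) = (spt n : ℤ) := by
  have hφ : Function.Injective (algebraMap ℚ⟦X⟧ (FractionRing ℚ⟦X⟧)) :=
    IsFractionRing.injective _ _
  have hplus := sptOPlus_eq_coeff (le_refl (2 * n))
  have hminus := sptOMinus_eq_coeff (le_refl (2 * n))
  have hspt := spt_eq_coeff (show n ≤ 2 * n by omega)
  rw [← coeff_expand_mul 2 two_ne_zero] at hspt
  have hdvd := X_pow_dvd_sub_of_bailey hφ (L := 2 * n)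
    (A := ∑ k ∈ range (2 * n), countGenFun (k + 1) (oddRestricted (2 * n) (k + 1)) -
      ∑ k ∈ range (2 * n), countGenFun (k + 1) (oddRestricted (2 * n) (k + 1)) *
        X ^ (k + 1).choose 2)
    (B := expand 2 two_ne_zero
      (∑ k ∈ range (2 * n), countGenFun (k + 1) (Ioc (k + 1) (2 * n)))) ?_ ?_
  · have h := X_pow_dvd_iff.1 hdvd (2 * n) (by omega)
    rw [map_sub, map_sub, ← hplus, ← hminus, ← hspt, sub_eq_zero] at h
    rw [sptO]
    exact_mod_cast h
  · rw [← sum_sub_distrib, map_sum, sum_mul]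
    refine sum_congr rfl fun k hk => ?_
    rw [map_sub, map_mul, map_pow]
    linear_combination (1 - algebraMap ℚ⟦X⟧ (FractionRing ℚ⟦X⟧) X ^ (k + 1).choose 2) *
      map_countGenFun_mul hφ (mem_range.1 hk)
  · rw [map_sum, map_sum, sum_mul]
    exact sum_congr rfl fun k hk => map_expand_countGenFun_mul hφ (mem_range.1 hk)

end SptO

theorem theorem2 (n : ℕ) : SptO.sptO (2 * n) = (SptO.spt n : ℤ) :=
  SptO.sptO_two_mul n
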